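/- Let $0<R\le\infty$, let $I=(0,R)$, let $f:I\to\mathbb R$ be an arbitrary function and let $n\ge 2$ be an integer. Write $\mathbf 1$ for the $n\times n$ matrix all of whose entries are $1$, and $f[A]=(f(a_{ij}))_{i,j}$ for a matrix $A=(a_{ij})$ with entries in $I$. Suppose that $f[A]$ is positive semidefinite for every $n\times n$ matrix of the form $A=a\mathbf 1+uu^T$ with $a\in[0,R)$ and $u\in[0,\sqrt{R-a})^n$ all of whose entries lie in $I$ (such an $A$ is automatically positive semidefinite of rank at most $2$; for $R=\infty$, $\sqrt{R-a}=\infty$). (1) If $n\ge 3$, then $f\in C^{n-3}(I)$, $f^{(k)}(x)\ge 0$ for all $x\in I$ and $0\le k\le n-3$, and $f^{(n-3)}$ is convex and nondecreasing on $I$. (2) If $n=2$, then $f$ is nonnegative and nondecreasing on $I$. (3) In particular, if $n\ge 2$ and $f\in C^{n-1}(I)$, then $f^{(k)}(x)\ge 0$ for all $x\in I$ and $0\le k\le n-1$. -/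

import Mathlib

/-- The open interval `(0, R)` of real numbers, where `R` may be `+∞`. -/
def openInterval (R : EReal) : Set ℝ := {x : ℝ | 0 < x ∧ (x : EReal) < R}

/-- The real symmetric positive semidefinite `n × n` matrices with all entries in `I`
and rank at most `k`. -/
def psdRankLE (n k : ℕ) (I : Set ℝ) : Set (Matrix (Fin n) (Fin n) ℝ) :=
  {A | A.PosSemidef ∧ (∀ i j, A i j ∈ I) ∧ A.rank ≤ k}

/-- The special matrix `a 𝟏 + u uᵀ`, where `𝟏` is the all-ones matrix. -/
def specialMatrix {n : ℕ} (a : ℝ) (u : Fin n → ℝ) : Matrix (Fin n) (Fin n) ℝ :=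
  a • Matrix.of (fun _ _ => (1 : ℝ)) + Matrix.vecMulVec u u

/-- `f[A]` is positive semidefinite for every `A = a 𝟏 + u uᵀ` with entries in `(0, R)`,
`a ∈ [0, R)` and `u ∈ [0, √(R - a))ⁿ`. As `R` may be `+∞`, the bound `u i < √(R - a)`
is written `a + (u i)² < R`. -/
def PreservesSpecial (n : ℕ) (R : EReal) (f : ℝ → ℝ) : Prop :=
  ∀ (a : ℝ) (u : Fin n → ℝ), 0 ≤ a → (a : EReal) < R →
    (∀ i, 0 ≤ u i ∧ ((a + u i ^ 2 : ℝ) : EReal) < R) →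
    specialMatrix a u ∈ psdRankLE n 2 (openInterval R) →
    ((specialMatrix a u).map f).PosSemidef

/-! If `f` is smooth, take `u = √t·(0, 1, …, n-1)` and test `f[a𝟏 + uuᵀ]` against the alternating
binomial weights of a `k`-th difference, `k < n`. In the Taylor expansion at `a` the order `m` term
carries the square of the `k`-th difference of `x ^ m` at `0`, so orders below `k` cancel. Dividing
by `t ^ k` and letting `t → 0+` gives `f⁽ᵏ⁾(a) ≥ 0` (`FormNonneg.iteratedDeriv_nonneg`).

For arbitrary `f`, two-point tests show that `f` is nonnegative, monotone and continuous. Averaging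
over forward translates then smooths `f` and preserves the hypothesis, since translating the
argument by `s ≥ 0` only replaces `a` by `a + s`. Derivative signs need not make sense in the limit,
but their consequences for finite differences do: differences of order at most `n - 3` are
nonnegative, monotone and convex. These are pointwise inequalities, hence survive the limit
(`DiffMonoConvex.of_tendsto`), and convexity turns them back into derivatives
(`DiffMonoConvex.regularity`). -/

open Set Filter Topology

/-! ### Finite differences: stability under limits, and regularity. -/

/-- `g` is nonnegative, nondecreasing and convex on `(0, r)`. -/
def NonnegMonoConvex (r : ℝ) (g : ℝ → ℝ) : Prop :=
  (∀ x ∈ Ioo 0 r, 0 ≤ g x) ∧ MonotoneOn g (Ioo 0 r) ∧ ConvexOn ℝ (Ioo 0 r) g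

/-- Iterated forward differences of `g` up to order `p` are nonnegative, nondecreasing and convex
on `(0, r)` (each difference on the subinterval where it is defined). -/
def DiffMonoConvex : ℕ → ℝ → (ℝ → ℝ) → Prop
  | 0 => NonnegMonoConvex
  | p + 1 => fun r g => NonnegMonoConvex r g ∧
      ∀ h > 0, DiffMonoConvex p (r - h) (fun x => g (x + h) - g x)

namespace DiffMonoConvex

theorem base {p : ℕ} {r : ℝ} {g : ℝ → ℝ} (hg : DiffMonoConvex p r g) :
    NonnegMonoConvex r g := by
  cases p with
  | zero => exact hg
  | succ p => exact hg.1

theorem anti {p : ℕ} {r r' : ℝ} {g : ℝ → ℝ} (hg : DiffMonoConvex p r g) (hr : r' ≤ r) :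
    DiffMonoConvex p r' g := by
  have key : ∀ {r r' : ℝ} {g : ℝ → ℝ}, r' ≤ r → NonnegMonoConvex r g →
      NonnegMonoConvex r' g := fun {r r' g} hr hg => by
    have hsub : Ioo 0 r' ⊆ Ioo 0 r := Ioo_subset_Ioo_right hr
    exact ⟨fun x hx => hg.1 x (hsub hx), hg.2.1.mono hsub, hg.2.2.subset hsub (convex_Ioo _ _)⟩
  induction p generalizing r r' g with
  | zero => exact key hr hg
  | succ p ih => exact ⟨key hr hg.1, fun h hh => ih (hg.2 h hh) (by linarith)⟩

theorem const_mul {p : ℕ} {r c : ℝ} {g : ℝ → ℝ} (hg : DiffMonoConvex p r g) (hc : 0 ≤ c) :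
    DiffMonoConvex p r (fun x => c * g x) := by
  have key : ∀ {r : ℝ} {g : ℝ → ℝ}, NonnegMonoConvex r g →
      NonnegMonoConvex r (fun x => c * g x) := fun {r g} hg =>
    ⟨fun x hx => mul_nonneg hc (hg.1 x hx),
      fun x hx y hy hxy => mul_le_mul_of_nonneg_left (hg.2.1 hx hy hxy) hc, hg.2.2.smul hc⟩
  induction p generalizing r g with
  | zero => exact key hg
  | succ p ih => exact ⟨key hg.1, fun h hh => by simpa [mul_sub] using ih (hg.2 h hh)⟩

theorem congr {p : ℕ} {r : ℝ} {g g' : ℝ → ℝ} (hg : DiffMonoConvex p r g)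
    (h : EqOn g g' (Ioo 0 r)) : DiffMonoConvex p r g' := by
  have key : ∀ {r : ℝ} {g g' : ℝ → ℝ}, EqOn g g' (Ioo 0 r) → NonnegMonoConvex r g →
      NonnegMonoConvex r g' := fun {r g g'} h hg =>
    ⟨fun x hx => h hx ▸ hg.1 x hx, hg.2.1.congr h, hg.2.2.congr h⟩
  induction p generalizing r g g' with
  | zero => exact key h hg
  | succ p ih =>
    refine ⟨key h hg.1, fun t ht => ih (hg.2 t ht) fun x hx => ?_⟩
    rw [h ⟨hx.1, by linarith [hx.2]⟩, h ⟨by linarith [hx.1], by linarith [hx.2]⟩]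

/-- All conditions are non-strict inequalities between finitely many values. Smaller intervals `(0,
r')` suffice, which leaves room for approximants whose domain shrinks. -/
theorem of_tendsto {ι : Type*} {l : Filter ι} [l.NeBot] {p : ℕ} {r : ℝ} {g : ℝ → ℝ}
    {G : ι → ℝ → ℝ} (hG : ∀ r' < r, ∀ᶠ i in l, DiffMonoConvex p r' (G i))
    (hlim : ∀ x ∈ Ioo 0 r, Tendsto (fun i => G i x) l (𝓝 (g x))) : DiffMonoConvex p r g := by
  have key : ∀ {r : ℝ} {g : ℝ → ℝ} {G : ι → ℝ → ℝ},
      (∀ r' < r, ∀ᶠ i in l, NonnegMonoConvex r' (G i)) →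
      (∀ x ∈ Ioo 0 r, Tendsto (fun i => G i x) l (𝓝 (g x))) → NonnegMonoConvex r g := by
    intro r g G hG hlim
    refine ⟨fun x hx => ?_, fun x hx y hy hxy => ?_, convex_Ioo _ _, ?_⟩
    · obtain ⟨r', h1, h2⟩ := exists_between hx.2
      exact ge_of_tendsto (hlim x hx) ((hG r' h2).mono fun i hi => hi.1 x ⟨hx.1, h1⟩)
    · obtain ⟨r', h1, h2⟩ := exists_between hy.2
      exact le_of_tendsto_of_tendsto (hlim x hx) (hlim y hy) ((hG r' h2).mono fun i hi =>
        hi.2.1 ⟨hx.1, hxy.trans_lt h1⟩ ⟨hy.1, h1⟩ hxy)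
    · intro x hx y hy a b ha hb hab
      obtain ⟨r', h1, h2⟩ := exists_between (max_lt hx.2 hy.2)
      have hx' : x ∈ Ioo 0 r' := ⟨hx.1, (le_max_left _ _).trans_lt h1⟩
      have hy' : y ∈ Ioo 0 r' := ⟨hy.1, (le_max_right _ _).trans_lt h1⟩
      exact le_of_tendsto_of_tendsto (hlim _ (convex_Ioo 0 r hx hy ha hb hab))
        (((hlim x hx).const_smul a).add ((hlim y hy).const_smul b))
        ((hG r' h2).mono fun i hi => hi.2.2.2 hx' hy' ha hb hab)
  induction p generalizing r g G with
  | zero => exact key hG hlim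
  | succ p ih =>
    refine ⟨key (fun r' hr' => (hG r' hr').mono fun i hi => hi.1) hlim, fun h hh =>
      ih (G := fun i x => G i (x + h) - G i x) (fun r' hr' => ?_) fun x hx => ?_⟩
    · filter_upwards [hG (r' + h) (by linarith)] with i hi
      simpa using hi.2 h hh
    · exact (hlim _ ⟨by linarith [hx.1], by linarith [hx.2]⟩).sub
        (hlim _ ⟨hx.1, by linarith [hx.2]⟩)

theorem hasDerivAt_iteratedDeriv {N : ℕ} {s : Set ℝ} {g : ℝ → ℝ} (hs : IsOpen s)
    (hg : ContDiffOn ℝ N g s) {k : ℕ} (hk : k < N) {x : ℝ} (hx : x ∈ s) :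
    HasDerivAt (iteratedDeriv k g) (iteratedDeriv (k + 1) g x) x := by
  have h1 : ContDiffAt ℝ N g x := hg.contDiffAt (hs.mem_nhds hx)
  have h2 : DifferentiableAt ℝ (iteratedDeriv k g) x := by
    rw [iteratedDeriv_eq_equiv_comp]
    exact (LinearIsometryEquiv.differentiableAt _).comp x
      (h1.differentiableAt_iteratedFDeriv (by exact_mod_cast hk))
  rw [iteratedDeriv_succ]
  exact h2.hasDerivAt

theorem monotoneOn_iteratedDeriv {N : ℕ} {r : ℝ} {g : ℝ → ℝ}
    (hg : ContDiffOn ℝ N g (Ioo 0 r)) {k : ℕ} (hk : k < N)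
    (hpos : ∀ x ∈ Ioo 0 r, 0 ≤ iteratedDeriv (k + 1) g x) :
    MonotoneOn (iteratedDeriv k g) (Ioo 0 r) := by
  have hd := fun x (hx : x ∈ Ioo 0 r) => hasDerivAt_iteratedDeriv isOpen_Ioo hg hk hx
  refine monotoneOn_of_deriv_nonneg (convex_Ioo _ _)
    (fun x hx => (hd x hx).continuousAt.continuousWithinAt) ?_ ?_
  · rw [interior_Ioo]
    exact fun x hx => (hd x hx).differentiableAt.differentiableWithinAt
  · rw [interior_Ioo]
    exact fun x hx => (hd x hx).deriv ▸ hpos x hx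

/-- Each difference costs one derivative: `g⁽ᵏ⁾(x + h) - g⁽ᵏ⁾(x) ≥ 0` because `g⁽ᵏ⁺¹⁾ ≥ 0`. The two
remaining orders give monotonicity and convexity. -/
theorem of_iteratedDeriv_nonneg {p : ℕ} {r : ℝ} {g : ℝ → ℝ}
    (hg : ContDiffOn ℝ (p + 2 : ℕ) g (Ioo 0 r))
    (hpos : ∀ k ≤ p + 2, ∀ x ∈ Ioo 0 r, 0 ≤ iteratedDeriv k g x) : DiffMonoConvex p r g := by
  have key : ∀ {p : ℕ} {r : ℝ} {g : ℝ → ℝ}, ContDiffOn ℝ (p + 2 : ℕ) g (Ioo 0 r) →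
      (∀ k ≤ p + 2, ∀ x ∈ Ioo 0 r, 0 ≤ iteratedDeriv k g x) → NonnegMonoConvex r g := by
    intro p r g hg hpos
    have hm0 := monotoneOn_iteratedDeriv hg (k := 0) (by omega) (hpos 1 (by omega))
    have hm1 := monotoneOn_iteratedDeriv hg (k := 1) (by omega) (hpos 2 (by omega))
    rw [iteratedDeriv_zero] at hm0
    rw [iteratedDeriv_one] at hm1
    refine ⟨by simpa using hpos 0 (by omega), hm0, ?_⟩
    have hdiff : DifferentiableOn ℝ g (Ioo 0 r) := hg.differentiableOn (by simp)
    apply MonotoneOn.convexOn_of_deriv (convex_Ioo _ _) hdiff.continuousOn <;>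
      rwa [interior_Ioo]
  induction p generalizing r g with
  | zero => exact key hg hpos
  | succ p ih =>
    refine ⟨key hg hpos, fun h hh => ih ?_ fun k hk x hx => ?_⟩
    · have hg' := hg.of_le (m := (p + 2 : ℕ)) (by norm_cast; omega)
      refine (hg'.comp (contDiff_id.add contDiff_const).contDiffOn fun x hx => ?_).sub
        (hg'.mono (Ioo_subset_Ioo_right (by linarith)))
      exact ⟨by simpa using by linarith [hx.1], by simpa using by linarith [hx.2]⟩
    · have hx1 : x ∈ Ioo 0 r := ⟨hx.1, by linarith [hx.2]⟩
      have hx2 : x + h ∈ Ioo 0 r := ⟨by linarith [hx.1], by linarith [hx.2]⟩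
      have hle : ((k : ℕ) : WithTop ℕ∞) ≤ (p + 1 + 2 : ℕ) := by norm_cast; omega
      have hc1 : ContDiffAt ℝ k g x := (hg.of_le hle).contDiffAt (isOpen_Ioo.mem_nhds hx1)
      have hc2 : ContDiffAt ℝ k g (x + h) := (hg.of_le hle).contDiffAt (isOpen_Ioo.mem_nhds hx2)
      have hc3 : ContDiffAt ℝ k (fun x => g (x + h)) x :=
        hc2.comp x (contDiff_id.add contDiff_const).contDiffAt
      rw [iteratedDeriv_fun_sub hc3 hc1, iteratedDeriv_comp_add_const, sub_nonneg]
      exact monotoneOn_iteratedDeriv hg (by omega) (hpos (k + 1) (by omega)) hx1 hx2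
        (by linarith)

/-- The right derivative of the convex `g` is a limit of difference quotients, so it inherits the
class of order `p`. In particular it is convex, hence continuous, and this forces the left and right
derivatives to agree. -/
theorem differentiableOn_and_deriv {p : ℕ} {r : ℝ} {g : ℝ → ℝ} (hg : DiffMonoConvex (p + 1) r g) :
    DifferentiableOn ℝ g (Ioo 0 r) ∧ DiffMonoConvex p r (deriv g) := by
  have hconv : ConvexOn ℝ (Ioo 0 r) g := hg.1.2.2
  have hint : interior (Ioo 0 r) = Ioo 0 r := interior_Ioo
  have hright : ∀ x ∈ Ioo 0 r, HasDerivWithinAt g (derivWithin g (Ioi x) x) (Ioi x) x :=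
    fun x hx => hconv.hasDerivWithinAt_rightDeriv_of_mem_interior (hint.symm ▸ hx)
  have hleft : ∀ x ∈ Ioo 0 r, HasDerivWithinAt g (derivWithin g (Iio x) x) (Iio x) x :=
    fun x hx => hconv.hasDerivWithinAt_leftDeriv_of_mem_interior (hint.symm ▸ hx)
  set D : ℝ → ℝ := fun x => derivWithin g (Ioi x) x with hD
  have hDM : DiffMonoConvex p r D := by
    refine of_tendsto (l := 𝓝[>] (0 : ℝ)) (G := fun h x => h⁻¹ * (g (x + h) - g x)) ?_ ?_
    · intro r' hr'
      filter_upwards [Ioo_mem_nhdsGT (sub_pos.2 hr')] with h hh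
      exact ((hg.2 h hh.1).anti (by linarith [hh.2])).const_mul (inv_nonneg.2 hh.1.le)
    · intro x hx
      have h1 := (hasDerivWithinAt_iff_tendsto_slope' (by simp)).1 (hright x hx)
      have h2 : Tendsto (fun h : ℝ => x + h) (𝓝[>] 0) (𝓝[>] x) := by
        refine tendsto_nhdsWithin_iff.2 ⟨?_, ?_⟩
        · have : Tendsto (fun h : ℝ => x + h) (𝓝 0) (𝓝 (x + 0)) :=
            (continuous_const.add continuous_id).tendsto 0
          rw [add_zero] at this
          exact this.mono_left nhdsWithin_le_nhds
        · filter_upwards [self_mem_nhdsWithin] with h hh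
          simpa using hh
      refine (h1.comp h2).congr fun h => ?_
      simp [slope]
  have hDcont : ContinuousOn D (Ioo 0 r) := hDM.base.2.2.continuousOn isOpen_Ioo
  have hder : ∀ x ∈ Ioo 0 r, HasDerivAt g (D x) x := by
    intro x hx
    have hle : derivWithin g (Iio x) x ≤ D x :=
      hconv.leftDeriv_le_rightDeriv_of_mem_interior (hint.symm ▸ hx)
    -- For `y < x`, `D y` is at most the slope from `y` to `x`, which is at most the left derivative
    -- at `x`; let `y → x`.
    have hge : D x ≤ derivWithin g (Iio x) x := by
      have ht : Tendsto D (𝓝[<] x) (𝓝 (D x)) :=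
        ((hDcont.continuousAt (isOpen_Ioo.mem_nhds hx)).tendsto).mono_left nhdsWithin_le_nhds
      refine le_of_tendsto ht ?_
      filter_upwards [Ioo_mem_nhdsLT hx.1] with y hy
      have hy' : y ∈ Ioo 0 r := ⟨hy.1, hy.2.trans hx.2⟩
      exact (hconv.rightDeriv_le_slope_of_mem_interior (hint.symm ▸ hy') hx hy.2).trans
        (hconv.slope_le_leftDeriv_of_mem_interior hy' (hint.symm ▸ hx) hy.2)
    have h1 := hleft x hx
    rw [le_antisymm hle hge] at h1
    have h2 := h1.union (hright x hx)
    rw [Iio_union_Ioi] at h2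
    rw [compl_eq_univ_sdiff, hasDerivWithinAt_sdiff_singleton] at h2
    exact hasDerivWithinAt_univ.1 h2
  exact ⟨fun x hx => (hder x hx).differentiableAt.differentiableWithinAt,
    hDM.congr fun x hx => (hder x hx).deriv.symm⟩

theorem regularity {p : ℕ} {r : ℝ} {g : ℝ → ℝ} (hg : DiffMonoConvex p r g) :
    ContDiffOn ℝ p g (Ioo 0 r) ∧ (∀ k ≤ p, ∀ x ∈ Ioo 0 r, 0 ≤ iteratedDeriv k g x) ∧
      ConvexOn ℝ (Ioo 0 r) (iteratedDeriv p g) ∧ MonotoneOn (iteratedDeriv p g) (Ioo 0 r) := by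
  induction p generalizing g with
  | zero =>
    refine ⟨contDiffOn_zero.2 (hg.2.2.continuousOn isOpen_Ioo), fun k hk => ?_, ?_, ?_⟩
    · obtain rfl : k = 0 := by omega
      simpa using hg.1
    · simpa using hg.2.2
    · simpa using hg.2.1
  | succ p ih =>
    obtain ⟨hd, hM⟩ := hg.differentiableOn_and_deriv
    obtain ⟨h1, h2, h3, h4⟩ := ih hM
    refine ⟨?_, fun k hk => ?_, ?_, ?_⟩
    · rw [Nat.cast_add, Nat.cast_one, contDiffOn_succ_iff_deriv_of_isOpen isOpen_Ioo]
      exact ⟨hd, by simp, h1⟩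
    · cases k with
      | zero => simpa using hg.base.1
      | succ k =>
        rw [iteratedDeriv_succ']
        exact h2 k (by omega)
    · rwa [iteratedDeriv_succ']
    · rwa [iteratedDeriv_succ']

end DiffMonoConvex

/-! ### Two-point tests: sign, monotonicity, continuity. -/

/-- The quadratic forms of `f[a 𝟏 + u uᵀ]` are nonnegative, for all `a 𝟏 + u uᵀ` with entries in
`(0, r)` and `a, u ≥ 0`. -/
def FormNonneg (n : ℕ) (r : ℝ) (f : ℝ → ℝ) : Prop :=
  ∀ (a : ℝ) (u v : Fin n → ℝ), 0 ≤ a → (∀ i, 0 ≤ u i) → (∀ i j, a + u i * u j ∈ Ioo 0 r) →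
    0 ≤ ∑ i, ∑ j, v i * v j * f (a + u i * u j)

theorem PreservesSpecial.formNonneg {n : ℕ} {R : EReal} {f : ℝ → ℝ} (hf : PreservesSpecial n R f)
    {r : ℝ} (hr : (r : EReal) ≤ R) : FormNonneg n r f := by
  intro a u v ha hu huv
  rcases isEmpty_or_nonempty (Fin n) with hn | ⟨⟨i₀⟩⟩
  · simp
  have har : a < r := lt_of_le_of_lt (by nlinarith [mul_self_nonneg (u i₀)]) (huv i₀ i₀).2
  have hentry : ∀ i j, specialMatrix a u i j = a + u i * u j := fun i j => by
    simp [specialMatrix, Matrix.vecMulVec]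
  have hone : (Matrix.of fun _ _ => (1 : ℝ) : Matrix (Fin n) (Fin n) ℝ) =
      Matrix.vecMulVec (fun _ => 1) (fun _ => 1) := by
    ext i j
    simp [Matrix.vecMulVec]
  have hpsd := hf a u ha (lt_of_lt_of_le (by exact_mod_cast har) hr)
    (fun i => ⟨hu i, lt_of_lt_of_le (by rw [sq]; exact_mod_cast (huv i i).2) hr⟩) ⟨?_, ?_, ?_⟩
  · have h := hpsd.dotProduct_mulVec_nonneg v
    refine h.trans_eq ?_
    simp only [dotProduct, Matrix.mulVec, Matrix.map_apply, hentry, Finset.mul_sum, star_trivial]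
    exact Finset.sum_congr rfl fun i _ => Finset.sum_congr rfl fun j _ => by ring
  · refine Matrix.PosSemidef.add ?_ ?_
    · rw [hone]
      have := Matrix.posSemidef_vecMulVec_self_star (fun _ : Fin n => (1 : ℝ))
      rw [star_trivial] at this
      exact this.smul ha
    · simpa using Matrix.posSemidef_vecMulVec_self_star u
  · intro i j
    rw [hentry]
    exact ⟨(huv i j).1, lt_of_lt_of_le (by exact_mod_cast (huv i j).2) hr⟩
  · have hmul : specialMatrix a u = (Matrix.of fun i => ![a, u i] : Matrix (Fin n) (Fin 2) ℝ) *
        (Matrix.of fun j => ![1, u j] : Matrix (Fin n) (Fin 2) ℝ).transpose := by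
      ext i j
      simp [hentry, Matrix.mul_apply, Fin.sum_univ_two]
    rw [hmul]
    exact (Matrix.rank_mul_le_left _ _).trans
      ((Matrix.rank_le_card_width _).trans_eq (Fintype.card_fin 2))

namespace FormNonneg

variable {n : ℕ} {r : ℝ} {f : ℝ → ℝ}

/-- The `2 × 2` case, with the first point repeated to fill the remaining indices. -/
theorem two (hf : FormNonneg n r f) (hn : 2 ≤ n) {a s t : ℝ} (ha : 0 ≤ a) (hs : 0 ≤ s)
    (ht : 0 ≤ t) (h1 : a + s * s ∈ Ioo 0 r) (h2 : a + s * t ∈ Ioo 0 r)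
    (h3 : a + t * t ∈ Ioo 0 r) (x y : ℝ) :
    0 ≤ x * x * f (a + s * s) + 2 * (x * y) * f (a + s * t) + y * y * f (a + t * t) := by
  obtain ⟨m, rfl⟩ : ∃ m, n = m + 2 := ⟨n - 2, by omega⟩
  have h2' : a + t * s ∈ Ioo 0 r := by rwa [mul_comm t s]
  have h := hf a (Fin.cons t fun _ => s) (Fin.cons y (Fin.cons x fun _ => 0)) ha
    (Fin.cases ht fun _ => hs)
    (Fin.cases (Fin.cases h3 fun _ => h2') fun i => Fin.cases h2 fun _ => h1)
  simp [Fin.sum_univ_succ] at h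
  rw [mul_comm t s] at h
  linarith

theorem nonneg (hf : FormNonneg n r f) (hn : 2 ≤ n) {x : ℝ} (hx : x ∈ Ioo 0 r) : 0 ≤ f x := by
  have := hf.two hn hx.1.le le_rfl le_rfl (by simpa using hx) (by simpa using hx)
    (by simpa using hx) 1 0
  simpa using this

/-- With `a = x` and `u = (0, √(y - x))` the entries are `x, x, x, y`, and the vector `(1, -1)`
yields `f y - f x`. -/
theorem monotoneOn (hf : FormNonneg n r f) (hn : 2 ≤ n) : MonotoneOn f (Ioo 0 r) := by
  intro x hx y hy hxy
  have hsq : √(y - x) * √(y - x) = y - x := Real.mul_self_sqrt (by linarith)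
  have := hf.two hn hx.1.le le_rfl (Real.sqrt_nonneg (y - x)) (by simpa using hx)
    (by simpa using hx) (by rw [hsq]; simpa using hy) 1 (-1)
  rw [hsq] at this
  simp at this
  linarith

/-- The case `a = 0`: midpoint convexity of `f` in the logarithmic variable. -/
theorem two_mul_apply_mul_le (hf : FormNonneg n r f) (hn : 2 ≤ n) {s t : ℝ} (hs : 0 < s) (ht : 0 < t)
    (hst : s ≤ t) (h : t * t < r) : 2 * f (s * t) ≤ f (s * s) + f (t * t) := by
  have := hf.two hn le_rfl hs.le ht.le (by simpa using ⟨by positivity, by nlinarith⟩)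
    (by simpa using ⟨by positivity, by nlinarith⟩) (by simpa using ⟨by positivity, h⟩) 1 (-1)
  simp at this
  linarith

/-- Monotonicity gives one-sided limits `L ≤ f x ≤ U`. A geometric mean lying to the right of `x`,
with one endpoint on each side, gives `2U ≤ L + U`, so there is no jump. -/
theorem continuousOn (hf : FormNonneg n r f) (hn : 2 ≤ n) : ContinuousOn f (Ioo 0 r) := by
  have hmono := hf.monotoneOn hn
  intro x hx
  refine ContinuousAt.continuousWithinAt ?_
  have hleft : Tendsto f (𝓝[<] x) (𝓝 (sSup (f '' Ioo 0 x))) := by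
    refine (hmono.mono (Ioo_subset_Ioo_right hx.2.le)).tendsto_nhdsWithin_Ioo_left ?_ ?_
    · exact nonempty_Ioo.2 hx.1
    · exact ⟨f x, by rintro _ ⟨y, hy, rfl⟩; exact hmono ⟨hy.1, hy.2.trans hx.2⟩ hx hy.2.le⟩
  have hright : Tendsto f (𝓝[>] x) (𝓝 (sInf (f '' Ioo x r))) := by
    refine (hmono.mono (Ioo_subset_Ioo_left hx.1.le)).tendsto_nhdsWithin_Ioo_right ?_ ?_
    · exact nonempty_Ioo.2 hx.2
    · exact ⟨f x, by rintro _ ⟨y, hy, rfl⟩; exact hmono hx ⟨hx.1.trans hy.1, hy.2⟩ hy.1.le⟩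
  set L := sSup (f '' Ioo 0 x)
  set U := sInf (f '' Ioo x r)
  have hLf : L ≤ f x := by
    refine le_of_tendsto hleft ?_
    filter_upwards [Ioo_mem_nhdsLT hx.1] with y hy
    exact hmono ⟨hy.1, hy.2.trans hx.2⟩ hx hy.2.le
  have hfU : f x ≤ U := by
    refine ge_of_tendsto hright ?_
    filter_upwards [Ioo_mem_nhdsGT hx.2] with y hy
    exact hmono hx ⟨hx.1.trans hy.1, hy.2⟩ hy.1.le
  -- compare `x e⁻²ʰ`, `x eʰ` and `x e⁴ʰ` as `h → 0+`
  have hexp : ∀ c : ℝ, Tendsto (fun h : ℝ => x * Real.exp (c * h)) (𝓝[>] 0) (𝓝 x) := fun c => by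
    have : Continuous fun h : ℝ => x * Real.exp (c * h) := by fun_prop
    simpa using (this.tendsto 0).mono_left nhdsWithin_le_nhds
  have hgt : ∀ c : ℝ, 0 < c → Tendsto (fun h : ℝ => x * Real.exp (c * h)) (𝓝[>] 0) (𝓝[>] x) := by
    refine fun c hc => tendsto_nhdsWithin_iff.2 ⟨hexp c, ?_⟩
    filter_upwards [self_mem_nhdsWithin] with h hh
    exact lt_mul_of_one_lt_right hx.1 (Real.one_lt_exp_iff.2 (mul_pos hc hh))
  have hlt : Tendsto (fun h : ℝ => x * Real.exp (-2 * h)) (𝓝[>] 0) (𝓝[<] x) := by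
    refine tendsto_nhdsWithin_iff.2 ⟨hexp _, ?_⟩
    filter_upwards [self_mem_nhdsWithin] with h hh
    exact mul_lt_of_lt_one_right hx.1 (Real.exp_lt_one_iff.2 (by linarith [mem_Ioi.1 hh]))
  have hUL : 2 * U ≤ L + U := by
    refine le_of_tendsto_of_tendsto ((hright.comp (hgt 1 one_pos)).const_mul 2)
      ((hleft.comp hlt).add (hright.comp (hgt 4 (by norm_num)))) ?_
    filter_upwards [self_mem_nhdsWithin, (hexp 4).eventually (gt_mem_nhds hx.2)] with h hh hr
    have hx2 : √x * √x = x := Real.mul_self_sqrt hx.1.le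
    have hsx : 0 < √x := Real.sqrt_pos.2 hx.1
    have e1 : (√x * Real.exp (-h)) * (√x * Real.exp (2 * h)) = x * Real.exp (1 * h) := by
      rw [mul_mul_mul_comm, hx2, ← Real.exp_add]; ring_nf
    have e2 : (√x * Real.exp (-h)) * (√x * Real.exp (-h)) = x * Real.exp (-2 * h) := by
      rw [mul_mul_mul_comm, hx2, ← Real.exp_add]; ring_nf
    have e3 : (√x * Real.exp (2 * h)) * (√x * Real.exp (2 * h)) = x * Real.exp (4 * h) := by
      rw [mul_mul_mul_comm, hx2, ← Real.exp_add]; ring_nf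
    have := hf.two_mul_apply_mul_le hn (s := √x * Real.exp (-h)) (t := √x * Real.exp (2 * h)) (by positivity)
      (by positivity) (mul_le_mul_of_nonneg_left
        (Real.exp_le_exp.2 (by linarith [mem_Ioi.1 hh])) hsx.le) (by rw [e3]; exact hr)
    rwa [e1, e2, e3] at this
  have hL : L = f x := by linarith
  have hU : U = f x := by linarith
  rw [hL] at hleft
  rw [hU] at hright
  rw [continuousAt_iff_continuous_left'_right']
  exact ⟨hleft, hright⟩

end FormNonneg

/-! ### Smoothing by forward averages. -/

/-- The average of `f` over `[x, x + δ]`. -/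
noncomputable def forwardAverage (δ : ℝ) (f : ℝ → ℝ) (x : ℝ) : ℝ :=
  δ⁻¹ * ∫ s in (0 : ℝ)..δ, f (x + s)

section forwardAverage

variable {δ r : ℝ} {f : ℝ → ℝ}

theorem continuousOn_comp_add (hf : ContinuousOn f (Ioo 0 r)) (hδ : 0 ≤ δ) {x : ℝ}
    (hx : x ∈ Ioo 0 (r - δ)) : ContinuousOn (fun s => f (x + s)) (uIcc 0 δ) := by
  rw [uIcc_of_le hδ]
  exact hf.comp (by fun_prop) fun s hs =>
    ⟨by linarith [hx.1, hs.1], by linarith [hx.2, hs.2]⟩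

theorem hasDerivAt_forwardAverage (hf : ContinuousOn f (Ioo 0 r)) (hδ : 0 ≤ δ) {x : ℝ}
    (hx : x ∈ Ioo 0 (r - δ)) :
    HasDerivAt (forwardAverage δ f) (δ⁻¹ * (f (x + δ) - f x)) x := by
  have hint : ∀ {y z : ℝ}, y ∈ Ioo 0 r → z ∈ Ioo 0 r →
      IntervalIntegrable f MeasureTheory.volume y z := fun hy hz =>
    (hf.mono ((ordConnected_Ioo).uIcc_subset hy hz)).intervalIntegrable
  have hprim : ∀ {y : ℝ}, y ∈ Ioo 0 r → HasDerivAt (fun u => ∫ s in x..u, f s) (f y) y :=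
    fun {y} hy => intervalIntegral.integral_hasDerivAt_right
      (hint ⟨hx.1, by linarith [hx.2]⟩ hy)
      (hf.stronglyMeasurableAtFilter isOpen_Ioo y hy)
      (hf.continuousAt (isOpen_Ioo.mem_nhds hy))
  have hx1 : x ∈ Ioo 0 r := ⟨hx.1, by linarith [hx.2]⟩
  have hx2 : x + δ ∈ Ioo 0 r := ⟨by linarith [hx.1], by linarith [hx.2]⟩
  have h := (((hprim hx2).comp_add_const x δ).sub (hprim hx1)).const_mul δ⁻¹
  refine h.congr_of_eventuallyEq ?_
  filter_upwards [isOpen_Ioo.mem_nhds hx] with y hy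
  have hy1 : y ∈ Ioo 0 r := ⟨hy.1, by linarith [hy.2]⟩
  have hy2 : y + δ ∈ Ioo 0 r := ⟨by linarith [hy.1], by linarith [hy.2]⟩
  simp only [forwardAverage, intervalIntegral.integral_comp_add_left, add_zero, Pi.sub_apply]
  rw [intervalIntegral.integral_interval_sub_left (hint hx1 hy2) (hint hx1 hy1)]

theorem contDiffOn_forwardAverage {m : ℕ} (hf : ContDiffOn ℝ m f (Ioo 0 r)) (hδ : 0 ≤ δ) :
    ContDiffOn ℝ (m + 1 : ℕ) (forwardAverage δ f) (Ioo 0 (r - δ)) := by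
  have hd := fun x hx => hasDerivAt_forwardAverage (x := x) hf.continuousOn hδ hx
  rw [Nat.cast_add, Nat.cast_one, contDiffOn_succ_iff_deriv_of_isOpen isOpen_Ioo]
  refine ⟨fun x hx => (hd x hx).differentiableAt.differentiableWithinAt, by simp, ?_⟩
  refine ContDiffOn.congr ?_ fun x hx => (hd x hx).deriv
  refine contDiffOn_const.mul ((hf.comp (contDiff_id.add contDiff_const).contDiffOn
    fun x hx => ?_).sub (hf.mono (Ioo_subset_Ioo_right (by linarith))))
  exact ⟨by simpa using by linarith [hx.1], by simpa using by linarith [hx.2]⟩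

/-- The quadratic form of the average is the average over `s ∈ [0, δ]` of the forms of `f` with `a +
s` in place of `a`. -/
theorem FormNonneg.average {n : ℕ} (hf : FormNonneg n r f)
    (hc : ContinuousOn f (Ioo 0 r)) (hδ : 0 ≤ δ) :
    FormNonneg n (r - δ) (forwardAverage δ f) := by
  intro a u v ha hu huv
  have hint : ∀ i j, IntervalIntegrable (fun s => v i * v j * f (a + u i * u j + s))
      MeasureTheory.volume 0 δ := fun i j =>
    (continuousOn_const.mul (continuousOn_comp_add hc hδ (huv i j))).intervalIntegrable
  have heq : ∑ i, ∑ j, v i * v j * forwardAverage δ f (a + u i * u j) =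
      δ⁻¹ * ∫ s in (0 : ℝ)..δ, ∑ i, ∑ j, v i * v j * f (a + u i * u j + s) := by
    rw [intervalIntegral.integral_finsetSum (fun i _ => ?_), Finset.mul_sum]
    swap
    · simpa [Finset.sum_fn] using IntervalIntegrable.sum Finset.univ fun j _ => hint i j
    refine Finset.sum_congr rfl fun i _ => ?_
    rw [intervalIntegral.integral_finsetSum fun j _ => hint i j, Finset.mul_sum]
    refine Finset.sum_congr rfl fun j _ => ?_
    rw [intervalIntegral.integral_const_mul, forwardAverage]
    ring
  rw [heq]
  refine mul_nonneg (inv_nonneg.2 hδ) (intervalIntegral.integral_nonneg hδ fun s hs => ?_)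
  simp_rw [add_right_comm a _ s]
  refine hf (a + s) u v (add_nonneg ha hs.1) hu fun i j => ?_
  exact ⟨by linarith [(huv i j).1, hs.1], by linarith [(huv i j).2, hs.2]⟩

theorem forwardAverage_mem_Icc (hm : MonotoneOn f (Ioo 0 r)) (hc : ContinuousOn f (Ioo 0 r))
    (hδ : 0 < δ) {x : ℝ} (hx : x ∈ Ioo 0 (r - δ)) :
    forwardAverage δ f x ∈ Icc (f x) (f (x + δ)) := by
  have hmem : ∀ {s : ℝ}, s ∈ Icc 0 δ → x + s ∈ Ioo 0 r := fun hs =>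
    ⟨by linarith [hx.1, hs.1], by linarith [hx.2, hs.2]⟩
  have hint := (continuousOn_comp_add hc hδ.le hx).intervalIntegrable (μ := MeasureTheory.volume)
  have hx0 : x ∈ Ioo 0 r := by simpa using hmem (left_mem_Icc.2 hδ.le)
  have h1 : ∫ _ in (0 : ℝ)..δ, f x ≤ ∫ s in (0 : ℝ)..δ, f (x + s) :=
    intervalIntegral.integral_mono_on hδ.le (by simp) hint fun s hs =>
      hm hx0 (hmem hs) (by linarith [hs.1])
  have h2 : ∫ s in (0 : ℝ)..δ, f (x + s) ≤ ∫ _ in (0 : ℝ)..δ, f (x + δ) :=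
    intervalIntegral.integral_mono_on hδ.le hint (by simp) fun s hs =>
      hm (hmem hs) (hmem (right_mem_Icc.2 hδ.le)) (by linarith [hs.2])
  rw [intervalIntegral.integral_const, sub_zero, smul_eq_mul] at h1 h2
  rw [forwardAverage, inv_mul_eq_div]
  exact ⟨(le_div_iff₀' hδ).2 h1, (div_le_iff₀' hδ).2 h2⟩

/-- Each average gains one derivative and costs `δ` of the interval; the two-sided bound yields
convergence to `f` as `δ → 0+`. -/
theorem FormNonneg.iterate_forwardAverage {n : ℕ} (hf : FormNonneg n r f) (hn : 2 ≤ n)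
    (hδ : 0 < δ) (N : ℕ) :
    FormNonneg n (r - N * δ) ((forwardAverage δ)^[N] f) ∧
      ContDiffOn ℝ N ((forwardAverage δ)^[N] f) (Ioo 0 (r - N * δ)) ∧
      ∀ x ∈ Ioo 0 (r - N * δ),
        (forwardAverage δ)^[N] f x ∈ Icc (f x) (f (x + N * δ)) := by
  induction N with
  | zero => simpa using ⟨hf, hf.continuousOn hn⟩
  | succ N ih =>
    obtain ⟨h1, h2, h3⟩ := ih
    have hr : r - (N + 1 : ℕ) * δ = r - N * δ - δ := by push_cast; ring
    rw [Function.iterate_succ_apply', hr]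
    refine ⟨h1.average h2.continuousOn hδ.le, contDiffOn_forwardAverage h2 hδ.le,
      fun x hx => ?_⟩
    have h := forwardAverage_mem_Icc (h1.monotoneOn hn) h2.continuousOn hδ hx
    refine ⟨(h3 x ⟨hx.1, by linarith [hx.2]⟩).1.trans h.1, h.2.trans ?_⟩
    have := (h3 (x + δ) ⟨by linarith [hx.1], by linarith [hx.2]⟩).2
    rwa [add_assoc, show δ + N * δ = (N + 1 : ℕ) * δ by push_cast; ring] at this

end forwardAverage

/-! ### Signs of derivatives from Taylor expansion. -/

/-- This is the `k`-th forward difference of `x ^ j` at `0`. The truncated exponent `k - i` is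
harmless for `i > k`, where the binomial coefficient vanishes. -/
theorem sum_alternating_choose_mul_pow {n k j : ℕ} (hk : k < n) (hj : j ≤ k) :
    ∑ i : Fin n, ((-1 : ℝ) ^ (k - i.1) * (k.choose i)) * (i : ℝ) ^ j =
      if j = k then (k.factorial : ℝ) else 0 := by
  rw [Fin.sum_univ_eq_sum_range (fun i => ((-1 : ℝ) ^ (k - i) * (k.choose i)) * (i : ℝ) ^ j) n]
  have hsub : Finset.range (k + 1) ⊆ Finset.range n := Finset.range_mono (by omega)
  rw [← Finset.sum_subset hsub fun i _ hi => by
    rw [Nat.choose_eq_zero_of_lt (by simpa using hi)]; simp]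
  have h := fwdDiff_iter_eq_sum_shift (h := (1 : ℝ)) (fun x : ℝ => x ^ j) k 0
  have h' : ∑ i ∈ Finset.range (k + 1), ((-1 : ℝ) ^ (k - i) * (k.choose i)) * (i : ℝ) ^ j =
      (fwdDiff (1 : ℝ))^[k] (fun x : ℝ => x ^ j) 0 := by
    rw [h]
    exact Finset.sum_congr rfl fun i _ => by simp
  rw [h']
  split_ifs with hjk
  · subst hjk
    rw [fwdDiff_iter_eq_factorial]
    simp
  · rw [fwdDiff_iter_pow_eq_zero_of_lt (lt_of_le_of_ne hj hjk)]
    rfl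

theorem FormNonneg.iteratedDeriv_nonneg {n k : ℕ} {r : ℝ} {f : ℝ → ℝ} (hf : FormNonneg n r f)
    (hk : k < n) (hc : ContDiffOn ℝ k f (Ioo 0 r)) {a : ℝ} (ha : a ∈ Ioo 0 r) :
    0 ≤ iteratedDeriv k f a := by
  set c : ℕ → ℝ := fun m => (m.factorial : ℝ)⁻¹ * iteratedDerivWithin m f (Ioo 0 r) a with hcdef
  set w : Fin n → ℝ := fun i => (-1 : ℝ) ^ (k - i.1) * (k.choose i) with hw
  set E : ℝ → ℝ := fun x => f x - taylorWithinEval f k (Ioo 0 r) a x with hE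
  have hfE : ∀ h, f (a + h) = ∑ m ∈ Finset.range (k + 1), c m * h ^ m + E (a + h) := fun h => by
    simp only [hE, taylor_within_apply, add_sub_cancel_left, smul_eq_mul, hcdef]
    rw [Finset.sum_congr rfl fun m _ => mul_right_comm _ _ _]
    ring
  have hpos : ∀ i j : Fin n, (0 : ℝ) ≤ (i : ℝ) * j := fun i j => by positivity
  have hlin : ∀ i j : Fin n, Tendsto (fun t : ℝ => a + t * ((i : ℝ) * j)) (𝓝[>] 0) (𝓝 a) :=
    fun i j => by
      have : Continuous fun t : ℝ => a + t * ((i : ℝ) * j) := by fun_prop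
      simpa using (this.tendsto 0).mono_left nhdsWithin_le_nhds
  -- the remainder terms are `o(tᵏ)`
  have hrem : ∀ i j : Fin n, Tendsto (fun t : ℝ => E (a + t * ((i : ℝ) * j)) / t ^ k)
      (𝓝[>] 0) (𝓝 0) := fun i j => by
    have h0 : E =o[𝓝 a] fun x => (x - a) ^ k := by
      have := taylor_isLittleO (convex_Ioo 0 r) ha hc
      rwa [isOpen_Ioo.nhdsWithin_eq ha] at this
    have h1 := h0.comp_tendsto (hlin i j)
    have h2 : ((fun x => (x - a) ^ k) ∘ fun t : ℝ => a + t * ((i : ℝ) * j)) =O[𝓝[>] 0]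
        fun t : ℝ => t ^ k := by
      have : ((fun x => (x - a) ^ k) ∘ fun t : ℝ => a + t * ((i : ℝ) * j)) =
          fun t => ((i : ℝ) * j) ^ k * t ^ k := by
        ext t
        simp [mul_pow, mul_comm]
      rw [this]
      exact Asymptotics.isBigO_const_mul_self _ _ _
    exact (h1.trans_isBigO h2).tendsto_div_nhds_zero
  -- the main term of the quadratic form
  have hmain : ∀ t : ℝ, ∑ i, ∑ j, w i * w j *
      ∑ m ∈ Finset.range (k + 1), c m * (t * ((i : ℝ) * j)) ^ m =
        c k * t ^ k * (k.factorial : ℝ) ^ 2 := fun t => by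
    -- Since `(ij)ᵐ = iᵐjᵐ`, the double sum in each order `m` is a perfect square.
    have : ∑ i, ∑ j, w i * w j * ∑ m ∈ Finset.range (k + 1), c m * (t * ((i : ℝ) * j)) ^ m =
        ∑ m ∈ Finset.range (k + 1), c m * t ^ m * (∑ i, w i * (i : ℝ) ^ m) ^ 2 := by
      simp_rw [Finset.mul_sum, sq, Finset.sum_mul_sum, Finset.mul_sum]
      simp_rw [Finset.sum_comm (s := Finset.univ) (t := Finset.range (k + 1))]
      refine Finset.sum_congr rfl fun m _ => Finset.sum_congr rfl fun i _ =>
        Finset.sum_congr rfl fun j _ => ?_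
      rw [mul_pow, mul_pow]
      ring
    rw [this, Finset.sum_eq_single_of_mem k (by simp) fun m hm hmk => ?_]
    · rw [hw, sum_alternating_choose_mul_pow hk le_rfl, if_pos rfl]
    · rw [hw, sum_alternating_choose_mul_pow hk (by simpa [Nat.lt_succ_iff] using hm), if_neg hmk]
      simp
  have hlim : Tendsto (fun t : ℝ => c k * (k.factorial : ℝ) ^ 2 +
      ∑ i, ∑ j, w i * w j * (E (a + t * ((i : ℝ) * j)) / t ^ k)) (𝓝[>] 0)
      (𝓝 (c k * (k.factorial : ℝ) ^ 2)) := by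
    have : Tendsto (fun t : ℝ => c k * (k.factorial : ℝ) ^ 2 +
        ∑ i, ∑ j, w i * w j * (E (a + t * ((i : ℝ) * j)) / t ^ k)) (𝓝[>] 0)
        (𝓝 (c k * (k.factorial : ℝ) ^ 2 + ∑ i, ∑ j, w i * w j * 0)) :=
      tendsto_const_nhds.add (tendsto_finsetSum _ fun i _ => tendsto_finsetSum _ fun j _ =>
        (hrem i j).const_mul _)
    simpa using this
  have hge : 0 ≤ c k * (k.factorial : ℝ) ^ 2 := by
    refine ge_of_tendsto hlim ?_
    have hev : ∀ᶠ t : ℝ in 𝓝[>] 0, ∀ i j : Fin n, a + t * ((i : ℝ) * j) < r :=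
      eventually_all.2 fun i => eventually_all.2 fun j =>
        (hlin i j).eventually (gt_mem_nhds ha.2)
    filter_upwards [self_mem_nhdsWithin, hev] with t ht htr
    have ht0 : 0 < t := ht
    have hu : ∀ i j : Fin n, √t * (i : ℝ) * (√t * (j : ℝ)) = t * ((i : ℝ) * j) := fun i j => by
      rw [mul_mul_mul_comm, Real.mul_self_sqrt ht0.le]
    have h := hf a (fun i => √t * i) w ha.1.le (fun i => by positivity) fun i j => by
      rw [hu]
      exact ⟨add_pos_of_pos_of_nonneg ha.1 (mul_nonneg ht0.le (hpos i j)), htr i j⟩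
    simp_rw [hu, hfE, mul_add, Finset.sum_add_distrib] at h
    rw [hmain] at h
    have htk : 0 < t ^ k := pow_pos ht0 k
    have h' := div_nonneg h htk.le
    refine h'.trans_eq ?_
    rw [add_div, Finset.sum_div]
    congr 1
    · field_simp
    · refine Finset.sum_congr rfl fun i _ => ?_
      rw [Finset.sum_div]
      exact Finset.sum_congr rfl fun j _ => by ring
  have hfac : (0 : ℝ) < k.factorial := by exact_mod_cast k.factorial_pos
  rw [← iteratedDerivWithin_of_isOpen isOpen_Ioo ha]
  have hck : c k * (k.factorial : ℝ) ^ 2 =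
      iteratedDerivWithin k f (Ioo 0 r) a * k.factorial := by
    simp only [hcdef]
    field_simp
  rw [hck] at hge
  exact nonneg_of_mul_nonneg_left hge hfac

/-! ### Removing the smoothing. -/

theorem FormNonneg.diffMonoConvex {p : ℕ} {r : ℝ} {f : ℝ → ℝ} (hf : FormNonneg (p + 3) r f) :
    DiffMonoConvex p r f := by
  -- Orders up to `p + 2` are what `DiffMonoConvex p` consumes, and also the largest that `(p +
  -- 3)`-point tests control.
  set N := p + 2
  have hδ : Tendsto (fun δ : ℝ => (N : ℝ) * δ) (𝓝[>] 0) (𝓝 0) := by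
    have : Continuous fun δ : ℝ => (N : ℝ) * δ := by fun_prop
    simpa using (this.tendsto 0).mono_left nhdsWithin_le_nhds
  refine DiffMonoConvex.of_tendsto (l := 𝓝[>] (0 : ℝ))
    (G := fun δ => (forwardAverage δ)^[N] f) (fun r' hr' => ?_) fun x hx => ?_
  · filter_upwards [self_mem_nhdsWithin, hδ.eventually (gt_mem_nhds (sub_pos.2 hr'))] with δ h1 h2
    obtain ⟨h3, h4, -⟩ := hf.iterate_forwardAverage (by omega) h1 N
    refine DiffMonoConvex.anti (DiffMonoConvex.of_iteratedDeriv_nonneg h4 fun k hk x hx =>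
      h3.iteratedDeriv_nonneg (by omega) (h4.of_le (by exact_mod_cast hk)) hx) (by linarith)
  · have hcont := (hf.continuousOn (by omega)).continuousAt (isOpen_Ioo.mem_nhds hx)
    have hlim : Tendsto (fun δ : ℝ => f (x + N * δ)) (𝓝[>] 0) (𝓝 (f x)) := by
      refine hcont.tendsto.comp ?_
      simpa using tendsto_const_nhds.add hδ
    have hev : ∀ᶠ δ : ℝ in 𝓝[>] 0,
        (forwardAverage δ)^[N] f x ∈ Icc (f x) (f (x + N * δ)) := by
      filter_upwards [self_mem_nhdsWithin, hδ.eventually (gt_mem_nhds (sub_pos.2 hx.2))]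
        with δ h1 h2
      exact (hf.iterate_forwardAverage (by omega) h1 N).2.2 x ⟨hx.1, by linarith⟩
    exact tendsto_of_tendsto_of_tendsto_of_le_of_le' tendsto_const_nhds hlim
      (hev.mono fun δ h => h.1) (hev.mono fun δ h => h.2)

/-! ### From bounded intervals `(0, r)` to `(0, R)` with `R` possibly infinite. -/

theorem isOpen_openInterval (R : EReal) : IsOpen (openInterval R) :=
  (isOpen_lt continuous_const continuous_id).inter
    (isOpen_lt continuous_coe_real_ereal continuous_const)

theorem Ioo_subset_openInterval {R : EReal} {r : ℝ} (hr : (r : EReal) ≤ R) :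
    Ioo 0 r ⊆ openInterval R := fun _ hx =>
  ⟨hx.1, lt_of_lt_of_le (by exact_mod_cast hx.2) hr⟩

theorem exists_real_gt_of_mem_openInterval {R : EReal} {x : ℝ} (hx : x ∈ openInterval R) :
    ∃ r : ℝ, (r : EReal) ≤ R ∧ x ∈ Ioo 0 r := by
  obtain ⟨r, h1, h2⟩ := EReal.lt_iff_exists_real_btwn.1 hx.2
  exact ⟨r, h2.le, hx.1, by exact_mod_cast h1⟩

theorem exists_real_gt_of_mem_openInterval₂ {R : EReal} {x y : ℝ} (hx : x ∈ openInterval R)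
    (hy : y ∈ openInterval R) : ∃ r : ℝ, (r : EReal) ≤ R ∧ x ∈ Ioo 0 r ∧ y ∈ Ioo 0 r := by
  rcases le_total x y with h | h
  · obtain ⟨r, h1, h2⟩ := exists_real_gt_of_mem_openInterval hy
    exact ⟨r, h1, ⟨hx.1, h.trans_lt h2.2⟩, h2⟩
  · obtain ⟨r, h1, h2⟩ := exists_real_gt_of_mem_openInterval hx
    exact ⟨r, h1, h2, ⟨hy.1, h.trans_lt h2.2⟩⟩

theorem convex_openInterval (R : EReal) : Convex ℝ (openInterval R) := by
  intro x hx y hy a b ha hb hab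
  obtain ⟨r, hr, hxr, hyr⟩ := exists_real_gt_of_mem_openInterval₂ hx hy
  exact Ioo_subset_openInterval hr (convex_Ioo 0 r hxr hyr ha hb hab)

theorem monotoneOn_openInterval {R : EReal} {g : ℝ → ℝ}
    (h : ∀ r : ℝ, (r : EReal) ≤ R → MonotoneOn g (Ioo 0 r)) :
    MonotoneOn g (openInterval R) := fun x hx y hy hxy => by
  obtain ⟨r, hr, hxr, hyr⟩ := exists_real_gt_of_mem_openInterval₂ hx hy
  exact h r hr hxr hyr hxy

theorem convexOn_openInterval {R : EReal} {g : ℝ → ℝ}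
    (h : ∀ r : ℝ, (r : EReal) ≤ R → ConvexOn ℝ (Ioo 0 r) g) :
    ConvexOn ℝ (openInterval R) g := by
  refine ⟨convex_openInterval R, fun x hx y hy a b ha hb hab => ?_⟩
  obtain ⟨r, hr, hxr, hyr⟩ := exists_real_gt_of_mem_openInterval₂ hx hy
  exact (h r hr).2 hxr hyr ha hb hab

theorem mainTheorem4 (R : EReal) (hR : 0 < R) (n : ℕ) (hn : 2 ≤ n) (f : ℝ → ℝ)
    (hf : PreservesSpecial n R f) :
    (3 ≤ n →
      ContDiffOn ℝ ((n - 3 : ℕ) : WithTop ℕ∞) f (openInterval R) ∧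
      (∀ k : ℕ, k ≤ n - 3 → ∀ x ∈ openInterval R,
        0 ≤ iteratedDerivWithin k f (openInterval R) x) ∧
      ConvexOn ℝ (openInterval R) (iteratedDerivWithin (n - 3) f (openInterval R)) ∧
      MonotoneOn (iteratedDerivWithin (n - 3) f (openInterval R)) (openInterval R)) ∧
    (n = 2 →
      (∀ x ∈ openInterval R, 0 ≤ f x) ∧ MonotoneOn f (openInterval R)) ∧
    (ContDiffOn ℝ ((n - 1 : ℕ) : WithTop ℕ∞) f (openInterval R) →
      ∀ k : ℕ, k ≤ n - 1 → ∀ x ∈ openInterval R,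
        0 ≤ iteratedDerivWithin k f (openInterval R) x) := by

  have hform : ∀ r : ℝ, (r : EReal) ≤ R → FormNonneg n r f := fun r hr => hf.formNonneg hr
  have hderiv : ∀ k : ℕ,
      EqOn (iteratedDerivWithin k f (openInterval R)) (iteratedDeriv k f) (openInterval R) :=
    fun k => iteratedDerivWithin_of_isOpen (isOpen_openInterval R)
  refine ⟨fun h3 => ?_, fun _ => ⟨fun x hx => ?_, ?_⟩, fun hc k hk x hx => ?_⟩
  · obtain ⟨p, rfl⟩ : ∃ p, n = p + 3 := ⟨n - 3, by omega⟩
    have hreg := fun r hr => (hform r hr).diffMonoConvex.regularity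
    rw [Nat.add_sub_cancel]
    refine ⟨fun x hx => ?_, fun k hk x hx => ?_, ?_, ?_⟩
    · obtain ⟨r, hr, hxr⟩ := exists_real_gt_of_mem_openInterval hx
      exact ((hreg r hr).1.contDiffAt (isOpen_Ioo.mem_nhds hxr)).contDiffWithinAt
    · obtain ⟨r, hr, hxr⟩ := exists_real_gt_of_mem_openInterval hx
      rw [hderiv k hx]
      exact (hreg r hr).2.1 k hk x hxr
    · exact (convexOn_openInterval fun r hr => (hreg r hr).2.2.1).congr (hderiv p).symm
    · exact (monotoneOn_openInterval fun r hr => (hreg r hr).2.2.2).congr (hderiv p).symm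
  · obtain ⟨r, hr, hxr⟩ := exists_real_gt_of_mem_openInterval hx
    exact (hform r hr).nonneg hn hxr
  · exact monotoneOn_openInterval fun r hr => (hform r hr).monotoneOn hn
  -- Here `f` itself is smooth enough for the Taylor argument, so no averaging is needed.
  · obtain ⟨r, hr, hxr⟩ := exists_real_gt_of_mem_openInterval hx
    rw [hderiv k hx]
    exact (hform r hr).iteratedDeriv_nonneg (by omega)
      ((hc.of_le (by exact_mod_cast hk)).mono (Ioo_subset_openInterval hr)) hxr
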